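/- Let $m\ge 1$ be an integer, $c<d$ real numbers, and $b,b'>0$ such that $(d-c)/b$ and $(d-c)/b'$ are integers. Write $\mathcal P_b[c,d]=\{c,c+b,\dots,d-b,d\}$, and $\mathcal P_b(u,v)=\{u+b,\dots,v-b\}$ whenever $(v-u)/b$ is an integer. For a partition $\Delta=\{c=x_0<x_1<\dots<x_{N+1}=d\}$ of $[c,d]$ let $S_m(\Delta)$ be the space of all functions $f:[c,d]\to\mathbb R$ in $C^{m-2}[c,d]$ (no condition if $m=1$) that coincide with a polynomial of degree at most $m-1$ on each of the intervals $[x_i,x_{i+1})$, $0\le i<N$, and $[x_N,x_{N+1}]$. Let $$B(x)=\frac1{m!}\sum_{i=0}^m(-1)^i\binom mi (x-i)_+^{m-1},\qquad \phi(x)=\frac1b\,B\!\left(\frac xb\right),$$ where $(x-i)_+^{m-1}$ is $(x-i)^{m-1}$ if $x>i$ and $0$ otherwise, and let $\phi_k$ be the restriction of $\phi(\cdot-k)$ to $[c,d]$. If $m=1$, where $\phi$ is discontinuous, the values of $\phi_k$ are taken to be the limits of $\phi(\cdot-k)$ from the right at the points of $[c,d)$ and the limit from the left at $d$. Suppose that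 $\Delta=\mathcal P_b[c,d]$ and $\Delta'=\mathcal P_{b'}[c,d]$ satisfy $\Delta\subset\Delta'$. Then $b/b'$ is an integer, and the dictionary $$\mathcal D_m(\Delta,b')=\{\phi_k : k\in\mathcal P_{b'}(c-mb,d)\}$$ satisfies $$\operatorname{span}\mathcal D_m(\Delta,b')=S_m(\Delta').$$ -/

import Mathlib

noncomputable section

namespace SplineDict

/-- `b` is an admissible distance for an equidistant partition of `[c,d]`:
`b > 0` and `(d - c) / b` is an integer. -/
def IsStep (b c d : ℝ) : Prop :=
  0 < b ∧ ∃ n : ℕ, (d - c) / b = n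

/-- The equidistant partition `P_b[u,v] = {u, u + b, …, v - b, v}`. -/
def gridClosed (b u v : ℝ) : Set ℝ :=
  {x | (∃ j : ℕ, x = u + j * b) ∧ x ∈ Set.Icc u v}

/-- The equidistant partition `P_b(u,v) = {u + b, …, v - b}`. -/
def gridOpen (b u v : ℝ) : Set ℝ :=
  {x | (∃ j : ℕ, x = u + j * b) ∧ x ∈ Set.Ioo u v}

/-- `u < v` are adjacent points of the partition `Δ`. -/
def Adjacent (Δ : Set ℝ) (u v : ℝ) : Prop :=
  u ∈ Δ ∧ v ∈ Δ ∧ u < v ∧ ∀ y ∈ Δ, ¬ (u < y ∧ y < v)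

/-- The subinterval between adjacent partition points `u`, `v` of a partition of `[c,d]`:
`[u,v)`, except that the last one, with `v = d`, is `[u,d]`. -/
def cell (d u v : ℝ) : Set ℝ :=
  {x | u ≤ x ∧ (x < v ∨ (x = v ∧ v = d))}

/-- The space `S_m(Δ)` of splines of order `m` with simple knots, for a partition `Δ` of `[c,d]`:
the functions in `C^{m-2}[c,d]` (no condition if `m = 1`) that coincide with a polynomial of
degree at most `m - 1` on each subinterval. -/
def splineSpace (m : ℕ) (c d : ℝ) (Δ : Set ℝ) : Submodule ℝ (Set.Icc c d → ℝ) where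
  carrier := {f |
    (2 ≤ m → ∃ g : ℝ → ℝ, ContDiffOn ℝ ((m - 2 : ℕ) : WithTop ℕ∞) g (Set.Icc c d) ∧
      ∀ x : Set.Icc c d, g x = f x) ∧
    ∀ u v : ℝ, Adjacent Δ u v → ∃ p ∈ Polynomial.degreeLT ℝ m,
      ∀ x : Set.Icc c d, (x : ℝ) ∈ cell d u v → f x = p.eval (x : ℝ)}
  add_mem' := by
    rintro f₁ f₂ ⟨h₁, k₁⟩ ⟨h₂, k₂⟩
    refine ⟨fun hm => ?_, fun u v huv => ?_⟩
    · obtain ⟨g₁, hg₁, e₁⟩ := h₁ hm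
      obtain ⟨g₂, hg₂, e₂⟩ := h₂ hm
      exact ⟨fun x => g₁ x + g₂ x, hg₁.add hg₂, fun x => by simp [e₁, e₂]⟩
    · obtain ⟨p₁, hp₁, e₁⟩ := k₁ u v huv
      obtain ⟨p₂, hp₂, e₂⟩ := k₂ u v huv
      exact ⟨p₁ + p₂, Submodule.add_mem _ hp₁ hp₂, fun x hx => by simp [e₁ x hx, e₂ x hx]⟩
  zero_mem' :=
    ⟨fun _ => ⟨fun _ => 0, contDiffOn_const, fun _ => rfl⟩,
      fun _ _ _ => ⟨0, Submodule.zero_mem _, fun x _ => by simp⟩⟩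
  smul_mem' := by
    rintro a f ⟨h, k⟩
    refine ⟨fun hm => ?_, fun u v huv => ?_⟩
    · obtain ⟨g, hg, e⟩ := h hm
      exact ⟨fun x => a * g x, contDiffOn_const.mul hg, fun x => by simp [e]⟩
    · obtain ⟨p, hp, e⟩ := k u v huv
      exact ⟨a • p, Submodule.smul_mem _ a hp, fun x hx => by simp [e x hx]⟩

/-- The truncated power `t_+^n`, equal to `t^n` if `t > 0` and to `0` otherwise. -/
def truncPow (n : ℕ) (t : ℝ) : ℝ := if 0 < t then t ^ n else 0

/-- The right-continuous version of the truncated power; it differs from `truncPow`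
only for `n = 0`, at `t = 0`. -/
def truncPowRight (n : ℕ) (t : ℝ) : ℝ := if 0 ≤ t then t ^ n else 0

/-- The cardinal B-spline of order `m` with knots `0, 1, …, m`. -/
def cardinalB (m : ℕ) (x : ℝ) : ℝ :=
  1 / (m.factorial : ℝ) *
    ∑ i ∈ Finset.range (m + 1), (-1 : ℝ) ^ i * (m.choose i : ℝ) * truncPow (m - 1) (x - i)

/-- The right-continuous version of the cardinal B-spline; it differs from `cardinalB`
only for `m = 1`, at the knots `0` and `1`. -/
def cardinalBRight (m : ℕ) (x : ℝ) : ℝ :=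
  1 / (m.factorial : ℝ) *
    ∑ i ∈ Finset.range (m + 1), (-1 : ℝ) ^ i * (m.choose i : ℝ) * truncPowRight (m - 1) (x - i)

/-- The prototype `φ(x) = (1/b) B(x/b)`. -/
def prototype (m : ℕ) (b x : ℝ) : ℝ := 1 / b * cardinalB m (x / b)

/-- The right-continuous version of the prototype. -/
def prototypeRight (m : ℕ) (b x : ℝ) : ℝ := 1 / b * cardinalBRight m (x / b)

/-- The function `φ_k`, the restriction of `φ(· - k)` to `[c,d]`.
For `m ≥ 2` this is literally `x ↦ φ(x - k)`, see `atom_eq`. For `m = 1`, where `φ` jumps, the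
values at the jumps are taken as for the subintervals `[x_i, x_{i+1})` and `[x_N, d]` in the
definition of the spline space: limits from the right on `[c,d)` and from the left at `d`
(`cardinalB` is left-continuous). -/
def atom (m : ℕ) (b c d k : ℝ) : Set.Icc c d → ℝ := fun x =>
  if (x : ℝ) < d then prototypeRight m b ((x : ℝ) - k) else prototype m b ((x : ℝ) - k)

/-- The dictionary `D_m(Δ,b') = {φ_k : k ∈ P_{b'}(c - mb, d)}`, where `Δ = P_b[c,d]`. -/
def dictionary (m : ℕ) (b b' c d : ℝ) : Set (Set.Icc c d → ℝ) :=
  atom m b c d '' gridOpen b' (c - m * b) d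

theorem truncPowRight_eq {n : ℕ} {t : ℝ} (h : n ≠ 0 ∨ t ≠ 0) :
    truncPowRight n t = truncPow n t := by
  unfold truncPowRight truncPow
  rcases lt_trichotomy t 0 with ht | rfl | ht
  · rw [if_neg (not_le.2 ht), if_neg (not_lt.2 ht.le)]
  · have hn : n ≠ 0 := by simpa using h
    simp [hn]
  · rw [if_pos ht.le, if_pos ht]

theorem atom_eq {m : ℕ} (hm : 2 ≤ m) (b c d k : ℝ) (x : Set.Icc c d) :
    atom m b c d k x = prototype m b ((x : ℝ) - k) := by
  have h : m - 1 ≠ 0 := by omega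
  unfold atom prototypeRight prototype cardinalBRight cardinalB
  simp only [truncPowRight_eq (Or.inl h), ite_self]

end SplineDict

end

namespace SplineDict

open Polynomial

/-! ### Truncated powers -/

/-! Write m = n + 1 and h = b'. Both spaces equal `truncSpan n c d h`, the span of the truncated
powers with knots in c + hℤ; knots at or left of c contribute polynomials on [c,d], knots at or
beyond d contribute zero.

Dictionary (`span_dictionary_eq_truncSpan`): an atom is, up to a nonzero factor, the m-th difference
with step b = rh of truncated powers. Its knots stay in c + hℤ, and its leftmost term can be solved
for, so downward induction on the knot recovers every truncated power. Atoms indexed outside the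
dictionary vanish on [c,d].

Splines (`truncSpan_eq_splineSpace`): shifted n-th powers span the polynomials of degree at most n,
which settles the first cell. At each later knot u, subtracting what has been matched leaves a
spline that is zero left of u; smoothness forces a multiple of (x - u)^n on the next cell. -/

theorem truncPow_zero_of_nonpos (n : ℕ) {t : ℝ} (ht : t ≤ 0) : truncPow n t = 0 :=
  if_neg (not_lt.2 ht)

theorem truncPow_of_pos (n : ℕ) {t : ℝ} (ht : 0 < t) : truncPow n t = t ^ n :=
  if_pos ht

theorem truncPowRight_zero_of_neg (n : ℕ) {t : ℝ} (ht : t < 0) : truncPowRight n t = 0 :=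
  if_neg (not_le.2 ht)

theorem truncPowRight_of_nonneg (n : ℕ) {t : ℝ} (ht : 0 ≤ t) : truncPowRight n t = t ^ n :=
  if_pos ht

theorem truncPow_div (n : ℕ) {b : ℝ} (hb : 0 < b) (t : ℝ) :
    truncPow n (t / b) = (1 / b) ^ n * truncPow n t := by
  unfold truncPow
  by_cases h : 0 < t
  · rw [if_pos h, if_pos (div_pos h hb), div_eq_mul_one_div, mul_pow, mul_comm]
  · rw [if_neg h, if_neg (by rwa [div_pos_iff_of_pos_right hb]), mul_zero]

theorem truncPowRight_div (n : ℕ) {b : ℝ} (hb : 0 < b) (t : ℝ) :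
    truncPowRight n (t / b) = (1 / b) ^ n * truncPowRight n t := by
  unfold truncPowRight
  by_cases h : 0 ≤ t
  · rw [if_pos h, if_pos (div_nonneg h hb.le), div_eq_mul_one_div, mul_pow, mul_comm]
  · rw [if_neg h, if_neg (not_le.2 (div_neg_of_neg_of_pos (not_le.1 h) hb)), mul_zero]

theorem truncPow_succ_eq_max_pow (n : ℕ) (t : ℝ) : truncPow (n + 1) t = max t 0 ^ (n + 1) := by
  rcases le_or_gt t 0 with h | h
  · rw [truncPow_zero_of_nonpos _ h, max_eq_right h, zero_pow n.succ_ne_zero]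
  · rw [truncPow_of_pos _ h, max_eq_left h.le]

theorem continuous_truncPow_succ (n : ℕ) : Continuous (truncPow (n + 1)) := by
  have : truncPow (n + 1) = fun t : ℝ => max t 0 ^ (n + 1) :=
    funext (truncPow_succ_eq_max_pow n)
  rw [this]
  fun_prop

theorem hasDerivAt_truncPow (n : ℕ) (t : ℝ) :
    HasDerivAt (truncPow (n + 2)) ((n + 2 : ℝ) * truncPow (n + 1) t) t := by
  rcases lt_trichotomy t 0 with h | rfl | h
  · rw [truncPow_zero_of_nonpos _ h.le, mul_zero]
    refine (hasDerivAt_const t (0 : ℝ)).congr_of_eventuallyEq ?_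
    filter_upwards [Iio_mem_nhds h] with x hx
    exact truncPow_zero_of_nonpos _ (le_of_lt hx)
  -- At the knot the difference quotient is itself the truncated power of one lower exponent, which
  -- is continuous and vanishes there.
  · rw [truncPow_zero_of_nonpos _ le_rfl, mul_zero, hasDerivAt_iff_tendsto_slope]
    have h0 : Filter.Tendsto (truncPow (n + 1)) (nhdsWithin 0 {0}ᶜ) (nhds 0) := by
      have := (continuous_truncPow_succ n).tendsto 0
      rw [truncPow_zero_of_nonpos _ le_rfl] at this
      exact this.mono_left nhdsWithin_le_nhds
    refine h0.congr' ?_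
    filter_upwards [self_mem_nhdsWithin] with x hx
    have hx : x ≠ 0 := hx
    rw [slope_def_field, truncPow_zero_of_nonpos _ le_rfl, sub_zero, sub_zero, eq_div_iff hx]
    simp only [truncPow]
    split_ifs <;> ring
  · rw [truncPow_of_pos _ h]
    have := hasDerivAt_pow (n + 2) t
    push_cast at this
    refine this.congr_of_eventuallyEq ?_
    filter_upwards [Ioi_mem_nhds h] with x hx
    exact truncPow_of_pos _ hx

theorem contDiff_truncPow (n : ℕ) : ContDiff ℝ n (truncPow (n + 1)) := by
  induction n with
  | zero => exact contDiff_zero.2 (continuous_truncPow_succ 0)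
  | succ n ih =>
    have hd : deriv (truncPow (n + 1 + 1)) = fun t => (n + 2 : ℝ) * truncPow (n + 1) t :=
      funext fun t => (hasDerivAt_truncPow n t).deriv
    rw [Nat.cast_add_one, contDiff_succ_iff_deriv, hd]
    refine ⟨fun t => (hasDerivAt_truncPow n t).differentiableAt, ?_, contDiff_const.mul ih⟩
    intro h
    exact absurd h (by simp)

/-! ### Polynomials -/

/-- Up to sign this is the (n+1)-th forward difference at 0 of a polynomial in i of degree at most
n. -/
theorem alternating_sum_choose_mul_pow_eq_zero (n : ℕ) (y b : ℝ) :
    ∑ i ∈ Finset.range (n + 1 + 1),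
      (-1 : ℝ) ^ i * ((n + 1).choose i : ℝ) * (y - i * b) ^ n = 0 := by
  have hdeg : ((C y - C b * X : ℝ[X]) ^ n).natDegree < n + 1 := by
    refine Nat.lt_succ_of_le (natDegree_pow_le.trans ?_)
    have : (C y - C b * X : ℝ[X]).natDegree ≤ 1 := by compute_degree
    nlinarith
  have h := congrFun (Polynomial.fwdDiff_iter_eq_zero_of_degree_lt hdeg) 0
  rw [fwdDiff_iter_eq_sum_shift] at h
  have h2 : ∑ i ∈ Finset.range (n + 1 + 1),
      (-1 : ℝ) ^ i * ((n + 1).choose i : ℝ) * (y - i * b) ^ n =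
      (-1) ^ (n + 1) * ∑ k ∈ Finset.range (n + 1 + 1),
        ((-1 : ℤ) ^ (n + 1 - k) * (n + 1).choose k) •
          ((C y - C b * X : ℝ[X]) ^ n).eval (0 + k • (1 : ℝ)) := by
    rw [Finset.mul_sum]
    refine Finset.sum_congr rfl fun k hk => ?_
    have hk : k ≤ n + 1 := Nat.lt_succ_iff.1 (Finset.mem_range.1 hk)
    have hs : (-1 : ℝ) ^ k = (-1) ^ (n + 1) * (-1) ^ (n + 1 - k) := by
      obtain ⟨q, hq⟩ := Nat.exists_eq_add_of_le hk
      rw [hq, Nat.add_sub_cancel_left, pow_add, mul_assoc, ← mul_pow]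
      simp
    simp only [zsmul_eq_mul, nsmul_eq_mul, eval_pow, eval_sub, eval_mul, eval_C, eval_X]
    push_cast
    rw [hs]
    ring
  rw [h2, h, Pi.zero_apply, mul_zero]

/-- The root at u has multiplicity at least n, so the degree bound leaves only a constant cofactor.
-/
theorem exists_eq_C_mul_X_sub_C_pow {n : ℕ} {u : ℝ} {p : ℝ[X]} (hp : p ∈ degreeLT ℝ (n + 1))
    (h : ∀ l < n, (derivative^[l] p).eval u = 0) : ∃ a : ℝ, p = C a * (X - C u) ^ n := by
  rcases eq_or_ne p 0 with rfl | h0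
  · exact ⟨0, by simp⟩
  have hmul : n ≤ p.rootMultiplicity u := by
    rcases n with _ | n
    · exact Nat.zero_le _
    · exact lt_rootMultiplicity_of_isRoot_iterate_derivative h0
        fun l hl => h l (Nat.lt_succ_of_le hl)
  obtain ⟨q, rfl⟩ := (le_rootMultiplicity_iff h0).1 hmul
  have hq0 : q ≠ 0 := right_ne_zero_of_mul h0
  have hdeg : ((X - C u) ^ n * q).natDegree < n + 1 :=
    (natDegree_lt_iff_degree_lt h0).2 (mem_degreeLT.1 hp)
  rw [((monic_X_sub_C u).pow n).natDegree_mul' hq0, natDegree_pow, natDegree_X_sub_C] at hdeg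
  refine ⟨q.coeff 0, ?_⟩
  rw [mul_comm]
  congr 1
  exact eq_C_of_natDegree_eq_zero (by omega)

theorem degreeLT_le_span_pow (n : ℕ) (a : ℕ → ℝ) (ha : Function.Injective a) :
    degreeLT ℝ (n + 1) ≤ Submodule.span ℝ (Set.range fun i => (X + C (a i)) ^ n) := by
  classical
  rw [degreeLT_eq_span_X_pow, Submodule.span_le]
  intro q hq
  obtain ⟨l, hl, rfl⟩ : ∃ l, l < n + 1 ∧ X ^ l = q := by simpa using hq
  let V : Matrix (Fin (n + 1)) (Fin (n + 1)) ℝ :=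
    (Matrix.vandermonde fun i : Fin (n + 1) => a i).transpose
  have hV : IsUnit V.det := by
    rw [Matrix.det_transpose, isUnit_iff_ne_zero, Matrix.det_vandermonde_ne_zero_iff]
    exact ha.comp Fin.val_injective
  -- The coefficient of X^k in ∑ w_i (X + a_i)^n is `n.choose k` times the moment ∑ w_i a_i^(n-k).
  -- Only the moment of order n - l may survive; the Vandermonde system prescribes all of them.
  let e : Fin (n + 1) → ℝ := fun s => if (s : ℕ) = n - l then ((n.choose l : ℝ))⁻¹ else 0
  let w := V⁻¹.mulVec e
  have hw : V.mulVec w = e := by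
    rw [Matrix.mulVec_mulVec, Matrix.mul_nonsing_inv _ hV, Matrix.one_mulVec]
  have hs : ∀ s, s < n + 1 → ∑ i : Fin (n + 1), a i ^ s * w i =
      if s = n - l then ((n.choose l : ℝ))⁻¹ else 0 := fun s hs => by
    have := congrFun hw ⟨s, hs⟩
    simpa [Matrix.mulVec, dotProduct, V, e, Matrix.vandermonde_apply] using this
  have key : (X : ℝ[X]) ^ l = ∑ i : Fin (n + 1), w i • (X + C (a i)) ^ n := by
    ext k
    simp only [finsetSum_coeff, coeff_smul, coeff_X_add_C_pow, coeff_X_pow, smul_eq_mul]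
    rcases le_or_gt k n with hk | hk
    · have : ∑ i : Fin (n + 1), w i * (a i ^ (n - k) * (n.choose k : ℝ)) =
          (∑ i : Fin (n + 1), a i ^ (n - k) * w i) * (n.choose k : ℝ) := by
        rw [Finset.sum_mul]
        exact Finset.sum_congr rfl fun i _ => by ring
      rw [this, hs _ (by omega)]
      by_cases hkl : k = l
      · subst hkl
        have : (n.choose k : ℝ) ≠ 0 := Nat.cast_ne_zero.2 (Nat.choose_pos hk).ne'
        simp [this]
      · rw [if_neg hkl, if_neg (by omega), zero_mul]
    · rw [if_neg (by omega)]
      simp [Nat.choose_eq_zero_of_lt hk]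
  rw [SetLike.mem_coe, key]
  exact Submodule.sum_mem _ fun i _ =>
    Submodule.smul_mem _ _ (Submodule.subset_span ⟨i, rfl⟩)

/-- If a `C^n` function vanishes to the left of `u` and agrees with a polynomial to the right of
`u`, then the derivatives of order at most `n` of that polynomial vanish at `u`. -/
theorem iterate_derivative_eval_eq_zero_of_contDiffOn {a u v : ℝ} (hau : a < u) (huv : u < v)
    (n : ℕ) : ∀ (p : ℝ[X]) (F : ℝ → ℝ), ContDiffOn ℝ n F (Set.Ioo a v) →
      (∀ x ∈ Set.Ioo a u, F x = 0) → (∀ x ∈ Set.Ioo u v, F x = p.eval x) →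
      ∀ l ≤ n, (derivative^[l] p).eval u = 0 := by
  have base : ∀ (p : ℝ[X]) (F : ℝ → ℝ), ContinuousOn F (Set.Ioo a v) →
      (∀ x ∈ Set.Ioo a u, F x = 0) → (∀ x ∈ Set.Ioo u v, F x = p.eval x) → p.eval u = 0 := by
    intro p F hF h0 hp
    have hc : ContinuousAt F u := hF.continuousAt (Ioo_mem_nhds hau huv)
    have hl : Filter.Tendsto F (nhdsWithin u (Set.Iio u)) (nhds 0) := by
      refine tendsto_const_nhds.congr' ?_
      filter_upwards [Ioo_mem_nhdsLT hau] with x hx using (h0 x hx).symm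
    have hr : Filter.Tendsto F (nhdsWithin u (Set.Ioi u)) (nhds (p.eval u)) := by
      refine ((p.continuous.tendsto u).mono_left nhdsWithin_le_nhds).congr' ?_
      filter_upwards [Ioo_mem_nhdsGT huv] with x hx using (hp x hx).symm
    have h1 := tendsto_nhds_unique hl (hc.tendsto.mono_left nhdsWithin_le_nhds)
    have h2 := tendsto_nhds_unique hr (hc.tendsto.mono_left nhdsWithin_le_nhds)
    rw [h2, ← h1]
  induction n with
  | zero =>
    intro p F hF h0 hp l hl
    obtain rfl : l = 0 := Nat.le_zero.1 hl
    exact base p F hF.continuousOn h0 hp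
  | succ n ih =>
    intro p F hF h0 hp l hl
    rcases l with _ | l
    · exact base p F hF.continuousOn h0 hp
    rw [Nat.cast_add_one, contDiffOn_succ_iff_deriv_of_isOpen isOpen_Ioo] at hF
    rw [Function.iterate_succ_apply]
    refine ih (derivative p) (deriv F) hF.2.2 (fun x hx => ?_) (fun x hx => ?_) l (by omega)
    · have : F =ᶠ[nhds x] fun _ => 0 := by
        filter_upwards [Ioo_mem_nhds hx.1 hx.2] with y hy using h0 y hy
      rw [this.deriv_eq, deriv_const]
    · have : F =ᶠ[nhds x] fun y => p.eval y := by
        filter_upwards [Ioo_mem_nhds hx.1 hx.2] with y hy using hp y hy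
      rw [this.deriv_eq, Polynomial.deriv]

/-! ### Shifted truncated powers on `[c,d]` -/

/-- The restriction of `(· - k)_+^n` to `[c,d]`, continuous from the right on `[c,d)` and from
the left at `d`. -/
noncomputable def truncShift (n : ℕ) (c d k : ℝ) : Set.Icc c d → ℝ := fun x =>
  if (x : ℝ) < d then truncPowRight n ((x : ℝ) - k) else truncPow n ((x : ℝ) - k)

variable {n : ℕ} {c d : ℝ}

/-- The strict bound k < d matters for n = 0: with k = x = d the left limit is 0, while the power is
1. -/
theorem truncShift_eq_pow {k : ℝ} {x : Set.Icc c d} (h : k ≤ x) (hk : k < d) :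
    truncShift n c d k x = ((x : ℝ) - k) ^ n := by
  unfold truncShift
  split_ifs with hx
  · exact truncPowRight_of_nonneg _ (sub_nonneg.2 h)
  · exact truncPow_of_pos _ (by linarith)

theorem truncShift_eq_zero {k : ℝ} {x : Set.Icc c d} (h : (x : ℝ) < k ∨ ((x : ℝ) = d ∧ d ≤ k)) :
    truncShift n c d k x = 0 := by
  unfold truncShift
  split_ifs with hx
  · exact truncPowRight_zero_of_neg _ (by rcases h with h | h <;> linarith)
  · exact truncPow_zero_of_nonpos _ (by rcases h with h | h <;> linarith)

theorem truncShift_eq_zero_of_le {k : ℝ} (h : d ≤ k) : truncShift n c d k = 0 := by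
  funext x
  refine truncShift_eq_zero ?_
  rcases x.2.2.lt_or_eq with hx | hx
  · exact Or.inl (hx.trans_le h)
  · exact Or.inr ⟨hx, h⟩

theorem atom_eq_sum_truncShift {b : ℝ} (hb : 0 < b) (k : ℝ) :
    atom (n + 1) b c d k = (1 / b * (1 / ((n + 1).factorial : ℝ)) * (1 / b) ^ n) •
      ∑ i ∈ Finset.range (n + 1 + 1),
        ((-1 : ℝ) ^ i * ((n + 1).choose i : ℝ)) • truncShift n c d (k + i * b) := by
  funext x
  have harg : ∀ i : ℕ, ((x : ℝ) - k) / b - i = ((x : ℝ) - (k + i * b)) / b := fun i => by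
    field_simp
    ring
  simp only [Pi.smul_apply, Finset.sum_apply, smul_eq_mul, truncShift, atom, prototypeRight,
    prototype, cardinalB, cardinalBRight, Nat.add_sub_cancel, harg, truncPow_div _ hb,
    truncPowRight_div _ hb]
  split_ifs <;>
  · simp only [Finset.mul_sum]
    exact Finset.sum_congr rfl fun i _ => by ring

theorem atom_eq_zero_of_right {b k : ℝ} (hb : 0 < b) (h : d ≤ k) : atom (n + 1) b c d k = 0 := by
  rw [atom_eq_sum_truncShift hb, Finset.sum_eq_zero, smul_zero]
  intro i _
  have : 0 ≤ (i : ℝ) * b := by positivity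
  rw [truncShift_eq_zero_of_le (by linarith), smul_zero]

/-- All knots lie at or left of c, so on [c,d] the truncated powers are plain powers and their
(n+1)-th difference vanishes. -/
theorem atom_eq_zero_of_left {b k : ℝ} (hb : 0 < b) (hcd : c < d)
    (h : k + ((n + 1 : ℕ) : ℝ) * b ≤ c) : atom (n + 1) b c d k = 0 := by
  rw [atom_eq_sum_truncShift hb]
  funext x
  rw [Pi.smul_apply, Finset.sum_apply, Pi.zero_apply, smul_eq_mul]
  refine mul_eq_zero_of_right _ ?_
  rw [← alternating_sum_choose_mul_pow_eq_zero n ((x : ℝ) - k) b]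
  refine Finset.sum_congr rfl fun i hi => ?_
  have hi : (i : ℝ) ≤ ((n + 1 : ℕ) : ℝ) :=
    Nat.cast_le.2 (Nat.lt_succ_iff.1 (Finset.mem_range.1 hi))
  have hib : k + i * b ≤ c := by nlinarith
  rw [Pi.smul_apply, smul_eq_mul, truncShift_eq_pow (hib.trans x.2.1) (by linarith), sub_sub]

/-- The span of the shifted truncated powers with knots in `c + hℤ`. -/
noncomputable def truncSpan (n : ℕ) (c d h : ℝ) : Submodule ℝ (Set.Icc c d → ℝ) :=
  Submodule.span ℝ (Set.range fun i : ℤ => truncShift n c d (c + i * h))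

theorem truncShift_mem_truncSpan (n : ℕ) (c d h : ℝ) (i : ℤ) :
    truncShift n c d (c + i * h) ∈ truncSpan n c d h :=
  Submodule.subset_span ⟨i, rfl⟩

/-! ### The span of the dictionary -/

theorem atom_mem_span_dictionary {b h : ℝ} {r : ℕ} (hcd : c < d) (hh : 0 < h) (hr : 0 < r)
    (hb : b = r * h) (i : ℤ) :
    atom (n + 1) b c d (c + i * h) ∈ Submodule.span ℝ (dictionary (n + 1) b h c d) := by
  have hb0 : 0 < b := by rw [hb]; positivity
  rcases le_or_gt d (c + i * h) with h1 | h1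
  · rw [atom_eq_zero_of_right hb0 h1]
    exact Submodule.zero_mem _
  rcases le_or_gt (c + i * h + ((n + 1 : ℕ) : ℝ) * b) c with h2 | h2
  · rw [atom_eq_zero_of_left hb0 hcd h2]
    exact Submodule.zero_mem _
  -- The dictionary grid starts at c - (n+1)b = c - (n+1)rh, which shifts the index by (n+1)r.
  refine Submodule.subset_span ⟨_, ⟨⟨(i + (n + 1) * r).toNat, ?_⟩, by linarith, h1⟩, rfl⟩
  have hpos : 0 ≤ i + (n + 1) * r := by
    have : 0 < ((i : ℝ) + (n + 1) * r) * h := by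
      rw [hb] at h2
      push_cast at h2
      linarith
    have := pos_of_mul_pos_left this hh.le
    exact_mod_cast this.le
  have : (((i + (n + 1) * r).toNat : ℕ) : ℝ) = (i : ℝ) + (n + 1) * r := by
    have := Int.toNat_of_nonneg hpos
    exact_mod_cast congrArg (Int.cast : ℤ → ℝ) this
  rw [this, hb]
  push_cast
  ring

theorem truncShift_mem_span_dictionary {b h : ℝ} {r N : ℕ} (hcd : c < d) (hh : 0 < h)
    (hr : 0 < r) (hb : b = r * h) (hd : d = c + N * h) (i : ℤ) :
    truncShift n c d (c + i * h) ∈ Submodule.span ℝ (dictionary (n + 1) b h c d) := by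
  have hb0 : 0 < b := by rw [hb]; positivity
  induction hs : (N - i).toNat using Nat.strong_induction_on generalizing i with
  | _ s ih =>
    rcases le_or_gt (N : ℤ) i with hi | hi
    · have hi : (N : ℝ) ≤ i := by exact_mod_cast hi
      rw [truncShift_eq_zero_of_le (by rw [hd]; nlinarith)]
      exact Submodule.zero_mem _
    have hatom := atom_mem_span_dictionary (n := n) hcd hh hr hb i
    rw [atom_eq_sum_truncShift hb0] at hatom
    have hK : 1 / b * (1 / ((n + 1).factorial : ℝ)) * (1 / b) ^ n ≠ 0 := by positivity
    -- Splitting off the zeroth term isolates the wanted truncated power, with coefficient 1; the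
    -- other knots lie further right and fall under the induction hypothesis.
    rw [Submodule.smul_mem_iff _ hK, Finset.sum_range_succ'] at hatom
    have hrest : ∑ j ∈ Finset.range (n + 1), ((-1 : ℝ) ^ (j + 1) * ((n + 1).choose (j + 1) : ℝ)) •
        truncShift n c d (c + i * h + ((j + 1 : ℕ) : ℝ) * b) ∈
          Submodule.span ℝ (dictionary (n + 1) b h c d) := by
      refine Submodule.sum_mem _ fun j _ => Submodule.smul_mem _ _ ?_
      have hpos : (0 : ℤ) < (j + 1) * r := by positivity
      have := ih (N - (i + (j + 1) * r)).toNat (by omega) (i + (j + 1) * r) rfl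
      convert this using 2
      rw [hb]
      push_cast
      ring
    have := (Submodule.add_mem_iff_right _ hrest).1 hatom
    simpa using this

theorem span_dictionary_eq_truncSpan {b h : ℝ} {r N : ℕ} (hcd : c < d) (hh : 0 < h)
    (hr : 0 < r) (hb : b = r * h) (hd : d = c + N * h) :
    Submodule.span ℝ (dictionary (n + 1) b h c d) = truncSpan n c d h := by
  refine le_antisymm (Submodule.span_le.2 ?_) (Submodule.span_le.2 ?_)
  · rintro _ ⟨k, ⟨⟨j, rfl⟩, -⟩, rfl⟩
    rw [SetLike.mem_coe, atom_eq_sum_truncShift (by rw [hb]; positivity)]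
    refine Submodule.smul_mem _ _ (Submodule.sum_mem _ fun i _ => Submodule.smul_mem _ _ ?_)
    convert truncShift_mem_truncSpan n c d h (-((n + 1) * r) + j + i * r) using 2
    rw [hb]
    push_cast
    ring
  · rintro _ ⟨i, rfl⟩
    exact truncShift_mem_span_dictionary hcd hh hr hb hd i

/-! ### The spline space -/

theorem exists_of_adjacent_gridClosed {h : ℝ} (hh : 0 < h) {u v : ℝ} (huv : Adjacent (gridClosed h c d) u v) :
    ∃ j : ℕ, u = c + j * h ∧ v = c + (j + 1) * h ∧ v ≤ d := by
  obtain ⟨⟨⟨j, rfl⟩, hu⟩, ⟨⟨l, rfl⟩, hv⟩, hlt, hno⟩ := huv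
  have hjl : j < l := by
    have : (j : ℝ) < l := lt_of_mul_lt_mul_right (by linarith) hh.le
    exact_mod_cast this
  refine ⟨j, rfl, ?_, hv.2⟩
  by_contra hne
  have hjl' : j + 1 < l := by
    refine lt_of_le_of_ne hjl fun hl => hne ?_
    rw [← hl]
    push_cast
    ring
  have hjl'' : (j : ℝ) + 1 < l := by exact_mod_cast hjl'
  have h1 : c + ((j : ℝ) + 1) * h < c + l * h := by nlinarith
  have h2 : c + (j : ℝ) * h < c + ((j : ℝ) + 1) * h := by nlinarith
  exact hno (c + ((j + 1 : ℕ) : ℝ) * h)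
    ⟨⟨j + 1, rfl⟩, by push_cast; linarith [hu.1], by push_cast; linarith [hv.2]⟩
    (by push_cast; exact ⟨h2, h1⟩)

theorem adjacent_gridClosed {h : ℝ} {N : ℕ} (hh : 0 < h) (hd : d = c + N * h) {j : ℕ}
    (hj : j < N) : Adjacent (gridClosed h c d) (c + j * h) (c + (j + 1) * h) := by
  have hj' : (j : ℝ) + 1 ≤ N := by exact_mod_cast hj
  have h0 : 0 ≤ (j : ℝ) * h := by positivity
  have h1 : ((j : ℝ) + 1) * h ≤ N * h := by nlinarith
  refine ⟨⟨⟨j, rfl⟩, by linarith, by linarith⟩, ⟨⟨j + 1, by push_cast; ring⟩, by linarith,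
    by linarith⟩, by linarith, ?_⟩
  rintro _ ⟨⟨l, rfl⟩, -⟩ ⟨hl1, hl2⟩
  have e1 : (j : ℝ) < l := lt_of_mul_lt_mul_right (by linarith) hh.le
  have e2 : (l : ℝ) < j + 1 := lt_of_mul_lt_mul_right (by linarith) hh.le
  have e1 : j < l := by exact_mod_cast e1
  have e2 : l < j + 1 := by exact_mod_cast e2
  omega

theorem truncShift_mem_splineSpace {h : ℝ} (hh : 0 < h) (i : ℤ) :
    truncShift n c d (c + i * h) ∈ splineSpace (n + 1) c d (gridClosed h c d) := by
  refine ⟨fun hm => ?_, fun u v huv => ?_⟩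
  · obtain ⟨k, rfl⟩ : ∃ k, n = k + 1 := ⟨n - 1, by omega⟩
    refine ⟨fun x => truncPow (k + 1) (x - (c + i * h)), ?_, fun x => ?_⟩
    · exact ((contDiff_truncPow k).comp (contDiff_id.sub contDiff_const)).contDiffOn
    · simp only [truncShift, truncPowRight_eq (Or.inl k.succ_ne_zero), ite_self]
  · obtain ⟨j, rfl, rfl, hv⟩ := exists_of_adjacent_gridClosed hh huv
    rcases le_or_gt i j with hij | hij
    · have hij : (i : ℝ) ≤ j := by exact_mod_cast hij
      have hk : c + i * h ≤ c + j * h := by nlinarith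
      refine ⟨(X - C (c + i * h)) ^ n, ?_, fun x hx => ?_⟩
      · rw [mem_degreeLT, degree_pow, degree_X_sub_C]
        simp only [nsmul_eq_mul, mul_one]
        exact_mod_cast Nat.lt_succ_self n
      · rw [truncShift_eq_pow (hk.trans hx.1) (by linarith)]
        simp
    · have hij : (j : ℝ) + 1 ≤ i := by exact_mod_cast hij
      have hk : c + (j + 1) * h ≤ c + i * h := by nlinarith
      refine ⟨0, Submodule.zero_mem _, fun x hx => ?_⟩
      rw [eval_zero]
      refine truncShift_eq_zero ?_
      rcases hx.2 with h1 | ⟨h1, h2⟩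
      · exact Or.inl (h1.trans_le hk)
      · exact Or.inr ⟨h1.trans h2, by rwa [← h2]⟩

theorem polynomial_restrict_mem_truncSpan {h : ℝ} (hcd : c < d) (hh : 0 < h) {p : ℝ[X]}
    (hp : p ∈ degreeLT ℝ (n + 1)) :
    (fun x : Set.Icc c d => p.eval (x : ℝ)) ∈ truncSpan n c d h := by
  let L : ℝ[X] →ₗ[ℝ] (Set.Icc c d → ℝ) := LinearMap.pi fun x => leval (x : ℝ)
  -- These shifts give the powers (x - (c - ih))^n, whose knots are at or left of c, so truncation
  -- has no effect on [c,d].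
  have hinj : Function.Injective fun i : ℕ => (i : ℝ) * h - c := fun i j hij => by
    have : (i : ℝ) * h = j * h := by simpa using hij
    exact_mod_cast mul_right_cancel₀ hh.ne' this
  have hmem := Submodule.mem_map_of_mem (f := L) (degreeLT_le_span_pow n _ hinj hp)
  rw [Submodule.map_span] at hmem
  refine Submodule.span_le.2 ?_ hmem
  rintro _ ⟨_, ⟨i, rfl⟩, rfl⟩
  suffices hL : L ((X + C ((i : ℝ) * h - c)) ^ n) = truncShift n c d (c + ((-i : ℤ) : ℝ) * h) by
    rw [SetLike.mem_coe]
    exact hL ▸ truncShift_mem_truncSpan n c d h (-i)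
  funext x
  have h0 : 0 ≤ (i : ℝ) * h := by positivity
  have h1 : c + ((-i : ℤ) : ℝ) * h ≤ c := by
    push_cast
    linarith
  rw [truncShift_eq_pow (h1.trans x.2.1) (by linarith)]
  simp only [L, LinearMap.pi_apply, leval_apply, eval_pow, eval_add, eval_X, eval_C]
  push_cast
  ring

theorem truncSpan_le_splineSpace {h : ℝ} (hh : 0 < h) :
    truncSpan n c d h ≤ splineSpace (n + 1) c d (gridClosed h c d) := by
  refine Submodule.span_le.2 ?_
  rintro _ ⟨i, rfl⟩
  exact truncShift_mem_splineSpace hh i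

/-- A spline vanishing to the left of an interior knot `u` is a multiple of `(· - u)^n` on the
cell to the right of `u`. -/
theorem exists_eq_mul_pow_of_eq_zero_left {Δ : Set ℝ} {f : Set.Icc c d → ℝ}
    (hf : f ∈ splineSpace (n + 1) c d Δ) {u v : ℝ} (huv : Adjacent Δ u v) (hcu : c < u)
    (hvd : v ≤ d) (h0 : ∀ x : Set.Icc c d, (x : ℝ) < u → f x = 0) :
    ∃ a : ℝ, ∀ x : Set.Icc c d, (x : ℝ) ∈ cell d u v → f x = a * ((x : ℝ) - u) ^ n := by
  obtain ⟨hsm, hpoly⟩ := hf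
  obtain ⟨p, hp, hfp⟩ := hpoly u v huv
  have hlt : u < v := huv.2.2.1
  -- Vacuous for n = 0, where no smoothness is available; otherwise order n - 1 suffices.
  have hder : ∀ l < n, (derivative^[l] p).eval u = 0 := by
    intro l hl
    obtain ⟨g, hg, hgf⟩ := hsm (by omega)
    refine iterate_derivative_eval_eq_zero_of_contDiffOn hcu hlt (n + 1 - 2) p g
      (hg.mono fun x hx => ⟨hx.1.le, hx.2.le.trans hvd⟩) (fun x hx => ?_) (fun x hx => ?_) l
      (by omega)
    · have hxI : x ∈ Set.Icc c d := ⟨hx.1.le, by linarith [hx.2]⟩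
      exact (hgf ⟨x, hxI⟩).trans (h0 ⟨x, hxI⟩ hx.2)
    · have hxI : x ∈ Set.Icc c d := ⟨by linarith [hx.1], by linarith [hx.2]⟩
      exact (hgf ⟨x, hxI⟩).trans (hfp ⟨x, hxI⟩ ⟨hx.1.le, Or.inl hx.2⟩)
  obtain ⟨a, rfl⟩ := exists_eq_C_mul_X_sub_C_pow hp hder
  exact ⟨a, fun x hx => by simpa using hfp x hx⟩

theorem splineSpace_le_truncSpan {h : ℝ} {N : ℕ} (hcd : c < d) (hh : 0 < h)
    (hd : d = c + N * h) :
    splineSpace (n + 1) c d (gridClosed h c d) ≤ truncSpan n c d h := by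
  intro f hf
  -- Agreement on the first j cells; the second alternative adds the endpoint d once the last cell
  -- is reached.
  have key : ∀ j : ℕ, j ≤ N → ∃ g ∈ truncSpan n c d h, ∀ x : Set.Icc c d,
      ((x : ℝ) < c + j * h ∨ ((x : ℝ) = c + j * h ∧ c + j * h = d)) → f x = g x := by
    intro j
    induction j with
    | zero =>
      refine fun _ => ⟨0, Submodule.zero_mem _, fun x hx => ?_⟩
      exfalso
      have := x.2.1
      simp only [Nat.cast_zero, zero_mul, add_zero] at hx
      rcases hx with hx | ⟨-, hx⟩ <;> linarith
    | succ j ih =>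
      intro hj
      have hadj := adjacent_gridClosed hh hd (Nat.lt_of_succ_le hj)
      push_cast
      rcases Nat.eq_zero_or_pos j with rfl | hj0
      · obtain ⟨p, hp, hfp⟩ := hf.2 _ _ hadj
        refine ⟨_, polynomial_restrict_mem_truncSpan hcd hh hp, fun x hx => hfp x ⟨?_, hx⟩⟩
        simpa using x.2.1
      obtain ⟨g, hg, hfg⟩ := ih (by omega)
      have hj0 : (0 : ℝ) < j := Nat.cast_pos.2 hj0
      have hjN : (j : ℝ) + 1 ≤ N := by exact_mod_cast hj
      have hcu : c < c + j * h := by nlinarith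
      have hvd : c + ((j : ℝ) + 1) * h ≤ d := by rw [hd]; nlinarith
      have hud : c + (j : ℝ) * h < d := hadj.2.2.1.trans_le hvd
      obtain ⟨a, ha⟩ := exists_eq_mul_pow_of_eq_zero_left
        (Submodule.sub_mem _ hf (truncSpan_le_splineSpace hh hg)) hadj hcu hvd
        (fun x hx => sub_eq_zero.2 (hfg x (Or.inl hx)))
      refine ⟨g + a • truncShift n c d (c + (j : ℤ) * h), Submodule.add_mem _ hg
        (Submodule.smul_mem _ _ (truncShift_mem_truncSpan n c d h j)), fun x hx => ?_⟩
      rw [Pi.add_apply, Pi.smul_apply, smul_eq_mul, Int.cast_natCast]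
      rcases lt_or_ge (x : ℝ) (c + j * h) with hxu | hxu
      · rw [truncShift_eq_zero (Or.inl hxu), mul_zero, add_zero]
        exact hfg x (Or.inl hxu)
      · rw [truncShift_eq_pow hxu hud, ← ha x ⟨hxu, hx⟩, Pi.sub_apply]
        ring
  obtain ⟨g, hg, hfg⟩ := key N le_rfl
  have : f = g := funext fun x => hfg x (by
    rw [← hd]
    rcases x.2.2.lt_or_eq with hx | hx
    · exact Or.inl hx
    · exact Or.inr ⟨hx, rfl⟩)
  rwa [this]

theorem truncSpan_eq_splineSpace {h : ℝ} {N : ℕ} (hcd : c < d) (hh : 0 < h)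
    (hd : d = c + N * h) :
    truncSpan n c d h = splineSpace (n + 1) c d (gridClosed h c d) :=
  le_antisymm (truncSpan_le_splineSpace hh) (splineSpace_le_truncSpan hcd hh hd)

theorem exists_nat_mul_of_gridClosed_subset {b b' : ℝ} (hcd : c < d) (hb : IsStep b c d)
    (hsub : gridClosed b c d ⊆ gridClosed b' c d) : ∃ r : ℕ, b = r * b' := by
  obtain ⟨hb0, M, hM⟩ := hb
  have hM' : d - c = M * b := (div_eq_iff hb0.ne').1 hM
  have hMpos : 1 ≤ M := by
    rcases Nat.eq_zero_or_pos M with rfl | h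
    · simp only [Nat.cast_zero, zero_mul] at hM'
      linarith
    · exact h
  have hMpos : (1 : ℝ) ≤ M := by exact_mod_cast hMpos
  -- The first coarse point after c already determines the ratio.
  obtain ⟨⟨r, hr⟩, -⟩ := hsub (show c + b ∈ gridClosed b c d from
    ⟨⟨1, by simp⟩, by linarith, by nlinarith⟩)
  exact ⟨r, by linarith⟩

end SplineDict

theorem theorem1 (m : ℕ) (hm : 1 ≤ m) (c d b b' : ℝ) (hcd : c < d)
    (hb : SplineDict.IsStep b c d) (hb' : SplineDict.IsStep b' c d)
    (hsub : SplineDict.gridClosed b c d ⊆ SplineDict.gridClosed b' c d) :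
    (∃ r : ℕ, b / b' = r) ∧
      Submodule.span ℝ (SplineDict.dictionary m b b' c d) =
        SplineDict.splineSpace m c d (SplineDict.gridClosed b' c d) := by
  obtain ⟨r, hr⟩ := SplineDict.exists_nat_mul_of_gridClosed_subset hcd hb hsub
  obtain ⟨hb'0, N, hN⟩ := hb'
  have hd : d = c + N * b' := by
    have := (div_eq_iff hb'0.ne').1 hN
    linarith
  have hr0 : 0 < r := by
    refine Nat.pos_of_ne_zero fun h => hb.1.ne' ?_
    rw [hr, h, Nat.cast_zero, zero_mul]
  obtain ⟨n, rfl⟩ : ∃ n, m = n + 1 := ⟨m - 1, by omega⟩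
  refine ⟨⟨r, (div_eq_iff hb'0.ne').2 hr⟩, ?_⟩
  rw [SplineDict.span_dictionary_eq_truncSpan hcd hb'0 hr0 hr hd,
    SplineDict.truncSpan_eq_splineSpace hcd hb'0 hd]
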